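/- Let $H$ be a quaternion skew field with centre $F$, i.e. a skew field with centre $F$ and $\dim_F H=4$ (of arbitrary characteristic). Let $\mathbb P(H)$ be the projective space of all subspaces of the $F$-vector space $H$; its points and lines are the subspaces of vector dimension one and two, respectively. A *parallelism* on $\mathbb P(H)$ is an equivalence relation on the set of lines such that each point is incident with precisely one line from each equivalence class. Parallelisms $\parallel_1,\parallel_2$ (not necessarily distinct) make $\mathbb P(H)$ into a *projective double space* $(\mathbb P(H),\parallel_1,\parallel_2)$ if for all triangles (triples of non-collinear points) $p_0,p_1,p_2$ the line through $p_2$ that is $\parallel_1$-parallel to the join of $p_0$ and $p_1$ and the line through $p_1$ that is $\parallel_2$-parallel to the join of $p_0$ and $p_2$ have a common point. For lines $M,N$ write $M\parallel_\ell N$ if $cM=N$ for some $c\in H\setminus\{0\}$, and $M\parallel_r N$ if $Md=N$ for some $d\in H\setminus\{0\}$. A *Clifford-like parallelism* of $(\mathbb P(H),\parallel_\ell,\parallel_r)$ is a parallelism $\parallel$ on $\mathbb P(H)$ such that, for all lines $M,N$, $M\parallel N$ implies $M\parallel_\ell N$ or $M\parallel_r N$. Let $\parallel$ be a Clifford-like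 parallelism of $(\mathbb P(H),\parallel_\ell,\parallel_r)$ with ${\parallel}\neq{\parallel_\ell}$ and ${\parallel}\neq{\parallel_r}$. Then there is no parallelism $\parallel'$ on $\mathbb P(H)$ that makes $\mathbb P(H)$ into a projective double space $(\mathbb P(H),\parallel,\parallel')$. -/

import Mathlib

/-- `H` is a quaternion skew field with centre `F`: a skew field whose centre is (the image of) `F`
and which has dimension four over `F`. The characteristic is arbitrary. -/
structure IsQuaternionSkewField (F H : Type*) [Field F] [DivisionRing H] [Algebra F H] : Prop where
  isCentral : Algebra.IsCentral F H
  finrank_eq : Module.finrank F H = 4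

/-- The points of the projective space of all subspaces of the vector space `V`:
the subspaces of vector dimension one. -/
abbrev ProjPoint (F V : Type*) [Field F] [AddCommGroup V] [Module F V] : Type _ :=
  {p : Submodule F V // Module.finrank F p = 1}

/-- The lines of the projective space of all subspaces of the vector space `V`:
the subspaces of vector dimension two. -/
abbrev ProjLine (F V : Type*) [Field F] [AddCommGroup V] [Module F V] : Type _ :=
  {M : Submodule F V // Module.finrank F M = 2}

/-- The point `p` is incident with the line `M`. -/
def ProjPoint.On {F V : Type*} [Field F] [AddCommGroup V] [Module F V]
    (p : ProjPoint F V) (M : ProjLine F V) : Prop :=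
  p.1 ≤ M.1

/-- A parallelism: an equivalence relation on the set of lines such that every point is incident
with precisely one line from each equivalence class. -/
structure IsParallelism {F V : Type*} [Field F] [AddCommGroup V] [Module F V]
    (par : ProjLine F V → ProjLine F V → Prop) : Prop where
  equivalence : Equivalence par
  existsUnique : ∀ (p : ProjPoint F V) (M : ProjLine F V), ∃! N : ProjLine F V, par M N ∧ p.On N

/-- Three points form a triangle if they are not on a common line. -/
def IsTriangle {F V : Type*} [Field F] [AddCommGroup V] [Module F V]
    (p₀ p₁ p₂ : ProjPoint F V) : Prop :=
  ¬ ∃ L : ProjLine F V, p₀.On L ∧ p₁.On L ∧ p₂.On L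

/-- The projective space of `V`, with the relations `parL` and `parR` on its lines, is a projective
double space: both relations are parallelisms, and for every triangle `p₀, p₁, p₂` the line `M₁`
through `p₂` which is `parL`-parallel to the join `A` of `p₀, p₁` and the line `M₂` through `p₁`
which is `parR`-parallel to the join `B` of `p₀, p₂` have a common point. -/
structure IsProjectiveDoubleSpace {F V : Type*} [Field F] [AddCommGroup V] [Module F V]
    (parL parR : ProjLine F V → ProjLine F V → Prop) : Prop where
  left : IsParallelism parL
  right : IsParallelism parR
  doubleSpace : ∀ p₀ p₁ p₂ : ProjPoint F V, IsTriangle p₀ p₁ p₂ →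
    ∀ A B M₁ M₂ : ProjLine F V, p₀.On A → p₁.On A → p₀.On B → p₂.On B →
      p₂.On M₁ → parL M₁ A → p₁.On M₂ → parR M₂ B →
        ∃ q : ProjPoint F V, q.On M₁ ∧ q.On M₂

/-- `par` is a Clifford-like parallelism with respect to `parL` and `parR`: it is a parallelism, and
`par`-parallel lines are always `parL`-parallel or `parR`-parallel. -/
structure IsCliffordLike {F V : Type*} [Field F] [AddCommGroup V] [Module F V]
    (parL parR par : ProjLine F V → ProjLine F V → Prop) : Prop where
  isParallelism : IsParallelism par
  left_or_right : ∀ M N : ProjLine F V, par M N → parL M N ∨ parR M N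

/-- The line `M` is left parallel to the line `N`: there is `c ≠ 0` in `H` with `c M = N`. -/
def LeftParallel (F H : Type*) [Field F] [DivisionRing H] [Algebra F H]
    (M N : ProjLine F H) : Prop :=
  ∃ c : H, c ≠ 0 ∧ M.1.map (LinearMap.mulLeft F c) = N.1

/-- The line `M` is right parallel to the line `N`: there is `d ≠ 0` in `H` with `M d = N`. -/
def RightParallel (F H : Type*) [Field F] [DivisionRing H] [Algebra F H]
    (M N : ProjLine F H) : Prop :=
  ∃ d : H, d ≠ 0 ∧ M.1.map (LinearMap.mulRight F d) = N.1

/-!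
Call a line `M` of left (right) type for an equivalence relation if all lines parallel to it are left
(right) parallel to it. Since an equivalence class inside the union of two equivalence relations lies
in one of them, every line is of left or of right type for a Clifford-like parallelism
(`IsCliffordLike.isLeftType_or_isRightType`).

Suppose that `par` is Clifford-like and that `par, par'` form a double space. Let `M, N` be distinct
`par'`-parallel lines, `p, q` independent vectors of `M` and `a` a nonzero vector of `N`. As the
`par`-parallel through `q` to the join of `p` and `a` meets `N`, there is a scalar `x` such that
`q p⁻¹ a + x q` (left type) or `a p⁻¹ q + x q` (right type) is in `N`. Lines are closed under
`(q, p, r) ↦ q p⁻¹ r`, because lines through `1` are subfields. Therefore two points of `M` whose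
joins with `a` have the same type force `N = M p⁻¹ a` or `N = a p⁻¹ M`. Among three points of `M` two
have the same type, so `par'` is Clifford-like too (`IsProjectiveDoubleSpace.isCliffordLike`).

Now let `B` be a line through `1` of right type for `par'`, and let `a ∉ B` be such that the join of
`1` and `a` is of right type for `par`. The axiom shows that `a t ∈ B a` for all `t ∈ B`. The same
holds for `a + 1`, and so `a` commutes with `B`, which is impossible as `B` is its own centralizer.
So `B` is the only line through `1` that can be of right type for `par`; likewise with left in place
of right (`IsProjectiveDoubleSpace.eq_of_isRightType`, `IsProjectiveDoubleSpace.eq_of_isLeftType`).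
If `par` is neither the left nor the right parallelism, then there are lines of both types through
`1`, and a third line `B` through `1` gives a contradiction, whatever its type for `par'`.
-/

/-! ### Points and lines in terms of vectors -/

section Lines

variable {F V : Type*} [Field F] [AddCommGroup V] [Module F V]

/-- The line joining two linearly independent vectors. -/
def ProjLine.join (p q : V) (h : LinearIndependent F ![p, q]) : ProjLine F V :=
  ⟨Submodule.span F {p, q}, by
    have := finrank_span_eq_card h
    rwa [Matrix.range_cons_cons_empty, Fintype.card_fin] at this⟩

theorem ProjLine.mem_join {p q x : V} (h : LinearIndependent F ![p, q]) :
    x ∈ (ProjLine.join p q h).1 ↔ ∃ u v : F, u • p + v • q = x :=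
  Submodule.mem_span_pair

theorem ProjLine.left_mem_join {p q : V} (h : LinearIndependent F ![p, q]) :
    p ∈ (ProjLine.join p q h).1 :=
  (mem_join h).2 ⟨1, 0, by simp⟩

theorem ProjLine.right_mem_join {p q : V} (h : LinearIndependent F ![p, q]) :
    q ∈ (ProjLine.join p q h).1 :=
  (mem_join h).2 ⟨0, 1, by simp⟩

/-- The point spanned by a nonzero vector. -/
def ProjPoint.ofVec (x : V) (hx : x ≠ 0) : ProjPoint F V :=
  ⟨Submodule.span F {x}, finrank_span_singleton hx⟩

theorem ProjPoint.ofVec_on {x : V} (hx : x ≠ 0) (M : ProjLine F V) :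
    (ProjPoint.ofVec x hx).On M ↔ x ∈ M.1 := by
  simp [ProjPoint.On, ProjPoint.ofVec, Submodule.span_singleton_le_iff_mem]

theorem ProjPoint.exists_ofVec (p : ProjPoint F V) :
    ∃ (x : V) (hx : x ≠ 0), p = ProjPoint.ofVec x hx := by
  obtain ⟨p, hp⟩ := p
  have hne : p ≠ ⊥ := by
    rintro rfl
    simp at hp
  obtain ⟨x, hx, hx0⟩ := p.exists_mem_ne_zero_of_ne_bot hne
  have : FiniteDimensional F p := FiniteDimensional.of_finrank_pos (by omega)
  refine ⟨x, hx0, Subtype.ext (Submodule.eq_of_le_of_finrank_eq ?_ ?_).symm⟩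
  · simpa [ProjPoint.ofVec, Submodule.span_singleton_le_iff_mem] using hx
  · rw [hp]
    exact finrank_span_singleton hx0

theorem ProjLine.finiteDimensional (M : ProjLine F V) : FiniteDimensional F M.1 :=
  FiniteDimensional.of_finrank_pos (by have := M.2; omega)

theorem ProjLine.eq_of_le {M N : ProjLine F V} (h : M.1 ≤ N.1) : M = N := by
  have := N.finiteDimensional
  exact Subtype.ext (Submodule.eq_of_le_of_finrank_eq h (M.2.trans N.2.symm))

theorem ProjLine.join_eq {p q : V} (h : LinearIndependent F ![p, q]) {M : ProjLine F V}
    (hp : p ∈ M.1) (hq : q ∈ M.1) : ProjLine.join p q h = M := by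
  refine ProjLine.eq_of_le (Submodule.span_le.2 ?_)
  rintro x (rfl | rfl) <;> assumption

/-- A line through a nonzero vector `p` contains a vector independent of `p`. -/
theorem ProjLine.exists_pair (M : ProjLine F V) {p : V} (hp : p ≠ 0) :
    ∃ q ∈ M.1, LinearIndependent F ![p, q] := by
  have hlt : ¬ M.1 ≤ Submodule.span F {p} := by
    intro hle
    have h1 := Submodule.finrank_mono hle
    rw [M.2, finrank_span_singleton hp] at h1
    omega
  obtain ⟨q, hq, hqp⟩ := SetLike.not_le_iff_exists.1 hlt
  refine ⟨q, hq, (LinearIndependent.pair_iff' hp).2 fun a ha => hqp ?_⟩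
  exact Submodule.mem_span_singleton.2 ⟨a, ha⟩

theorem ProjLine.exists_ne_zero (M : ProjLine F V) : ∃ p ∈ M.1, p ≠ 0 := by
  refine M.1.exists_mem_ne_zero_of_ne_bot ?_
  intro h
  have := M.2
  rw [h] at this
  simp at this

theorem pair_independent_of_mem_of_notMem {M : Submodule F V} {p a : V} (hp : p ∈ M) (hp0 : p ≠ 0)
    (ha : a ∉ M) : LinearIndependent F ![p, a] :=
  (LinearIndependent.pair_iff' hp0).2 fun u hu => ha (hu ▸ M.smul_mem u hp)

theorem IsParallelism.existsUnique_mem {par : ProjLine F V → ProjLine F V → Prop}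
    (h : IsParallelism par) {x : V} (hx : x ≠ 0) (M : ProjLine F V) :
    ∃! N : ProjLine F V, par M N ∧ x ∈ N.1 := by
  simpa only [ProjPoint.ofVec_on] using h.existsUnique (ProjPoint.ofVec x hx) M

/-- Distinct parallel lines have no common point. -/
theorem IsParallelism.eq_zero_of_mem {par : ProjLine F V → ProjLine F V → Prop}
    (h : IsParallelism par) {M N : ProjLine F V} (hMN : par M N) (hne : M ≠ N) {x : V}
    (hM : x ∈ M.1) (hN : x ∈ N.1) : x = 0 := by
  by_contra hx
  exact hne ((h.existsUnique_mem hx M).unique ⟨h.equivalence.refl M, hM⟩ ⟨hMN, hN⟩)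

/-- The double space axiom in vectors: `M` plays the line `p₀ p₂`, and `N` is the line through `a`
which is parallel to `M` for the second parallelism. -/
theorem IsProjectiveDoubleSpace.exists_mem {par par' : ProjLine F V → ProjLine F V → Prop}
    (h : IsProjectiveDoubleSpace par par') {M N A K : ProjLine F V} (hMN : par' M N)
    (hne : M ≠ N) {p₀ p₂ a : V} (hp : LinearIndependent F ![p₀, p₂]) (hp₀ : p₀ ∈ M.1)
    (hp₂ : p₂ ∈ M.1) (ha : a ∈ N.1) (ha0 : a ≠ 0) (hA₀ : p₀ ∈ A.1) (hAa : a ∈ A.1)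
    (hAK : par A K) (hK : p₂ ∈ K.1) : ∃ q : V, q ≠ 0 ∧ q ∈ K.1 ∧ q ∈ N.1 := by
  have h0 : p₀ ≠ 0 := hp.ne_zero 0
  have h2 : p₂ ≠ 0 := hp.ne_zero 1
  have htri : IsTriangle (ProjPoint.ofVec (F := F) p₀ h0) (ProjPoint.ofVec a ha0)
      (ProjPoint.ofVec p₂ h2) := by
    rintro ⟨L, hL0, hLa, hL2⟩
    rw [ProjPoint.ofVec_on] at hL0 hLa hL2
    have hLM : L = M := (ProjLine.join_eq hp hL0 hL2).symm.trans (ProjLine.join_eq hp hp₀ hp₂)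
    exact ha0 (h.right.eq_zero_of_mem hMN hne (hLM ▸ hLa) ha)
  obtain ⟨q, hqK, hqN⟩ := h.doubleSpace _ _ _ htri A M K N
    ((ProjPoint.ofVec_on h0 A).2 hA₀) ((ProjPoint.ofVec_on ha0 A).2 hAa)
    ((ProjPoint.ofVec_on h0 M).2 hp₀) ((ProjPoint.ofVec_on h2 M).2 hp₂)
    ((ProjPoint.ofVec_on h2 K).2 hK) (h.left.equivalence.symm hAK)
    ((ProjPoint.ofVec_on ha0 N).2 ha) (h.right.equivalence.symm hMN)
  obtain ⟨x, hx, rfl⟩ := q.exists_ofVec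
  exact ⟨x, hx, (ProjPoint.ofVec_on hx K).1 hqK, (ProjPoint.ofVec_on hx N).1 hqN⟩

end Lines

/-! ### Lines of a quaternion skew field, left and right parallels -/

section Quaternion

variable {F H : Type*} [Field F] [DivisionRing H] [Algebra F H]

theorem IsQuaternionSkewField.finiteDimensional (hH : IsQuaternionSkewField F H) :
    FiniteDimensional F H :=
  FiniteDimensional.of_finrank_pos (by rw [hH.finrank_eq]; omega)

/-- An element which commutes with everything is a scalar, so it spans no line with `1`. -/
theorem IsQuaternionSkewField.not_independent_of_central (hH : IsQuaternionSkewField F H) {t : H}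
    (ht : ∀ x : H, t * x = x * t) : ¬ LinearIndependent F ![1, t] := by
  intro h
  have := hH.isCentral.out (Subalgebra.mem_center_iff.2 fun x => (ht x).symm)
  obtain ⟨u, hu⟩ := Algebra.mem_bot.1 this
  refine (LinearIndependent.pair_iff' one_ne_zero).1 h u ?_
  rw [← hu, Algebra.algebraMap_eq_smul_one]

/-- A line through `1` is closed under multiplication. It is spanned by `1` and some `t`, and the
commutative division algebra `K = F[t]` has dimension two: if the dimension were at least three,
then `K` and `K h` would meet nontrivially for every `h`, so that `K = H` would be commutative. -/
theorem IsQuaternionSkewField.mul_mem (hH : IsQuaternionSkewField F H) {M : ProjLine F H}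
    (h1 : (1 : H) ∈ M.1) {x y : H} (hx : x ∈ M.1) (hy : y ∈ M.1) : x * y ∈ M.1 := by
  have hfd := hH.finiteDimensional
  obtain ⟨t, ht, hind⟩ := M.exists_pair (one_ne_zero (α := H))
  set K : Subalgebra F H := Algebra.adjoin F {t} with hK
  have htK : t ∈ K := Algebra.self_mem_adjoin_singleton F t
  have hMK : M.1 ≤ Subalgebra.toSubmodule K := by
    intro z hz
    rw [← ProjLine.join_eq hind h1 ht, ProjLine.mem_join] at hz
    obtain ⟨u, v, rfl⟩ := hz
    exact K.add_mem (K.smul_mem K.one_mem u) (K.smul_mem htK v)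
  have hfin : Module.finrank F (Subalgebra.toSubmodule K) ≤ 2 := by
    by_contra hlt
    refine hH.not_independent_of_central (t := t) (fun h => ?_) hind
    have hmem : h ∈ K := by
      by_contra hh
      have hh0 : h ≠ 0 := fun e => hh (e ▸ K.zero_mem)
      have hinj : Function.Injective (LinearMap.mulRight F h) :=
        fun a b hab => mul_right_cancel₀ hh0 hab
      have hmap := (Submodule.equivMapOfInjective _ hinj (Subalgebra.toSubmodule K)).finrank_eq
      have hsum := Submodule.finrank_sup_add_finrank_inf_eq (Subalgebra.toSubmodule K)
        ((Subalgebra.toSubmodule K).map (LinearMap.mulRight F h))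
      have hle := Submodule.finrank_le (Subalgebra.toSubmodule K ⊔
        (Subalgebra.toSubmodule K).map (LinearMap.mulRight F h))
      rw [hH.finrank_eq] at hle
      have hne : Subalgebra.toSubmodule K ⊓
          (Subalgebra.toSubmodule K).map (LinearMap.mulRight F h) ≠ ⊥ := by
        intro e
        rw [e, finrank_bot] at hsum
        omega
      obtain ⟨z, ⟨hzK, k, hk, hkz⟩, hz0⟩ := Submodule.exists_mem_ne_zero_of_ne_bot hne
      replace hkz : k * h = z := hkz
      have hk0 : k ≠ 0 := by
        rintro rfl
        exact hz0 (by rw [← hkz, zero_mul])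
      have hkinv : k⁻¹ ∈ K :=
        Algebra.adjoin_le (Set.singleton_subset_iff.2 hk)
          (IsIntegral.inv_mem_adjoin (Algebra.IsIntegral.isIntegral (R := F) k))
      apply hh
      have : h = k⁻¹ * z := by rw [← hkz, inv_mul_cancel_left₀ hk0]
      rw [this]
      exact K.mul_mem hkinv hzK
    exact (Algebra.commute_of_mem_adjoin_self hmem).eq
  have heq : M.1 = Subalgebra.toSubmodule K :=
    Submodule.eq_of_le_of_finrank_le hMK (by rw [M.2]; exact hfin)
  rw [heq] at hx hy ⊢
  exact K.mul_mem hx hy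

/-- The line `c M`. -/
def ProjLine.mulLeft (c : H) (hc : c ≠ 0) (M : ProjLine F H) : ProjLine F H :=
  ⟨M.1.map (LinearMap.mulLeft F c), by
    have hinj : Function.Injective (LinearMap.mulLeft F c) :=
      fun _ _ hab => mul_left_cancel₀ hc hab
    rw [← (Submodule.equivMapOfInjective _ hinj M.1).finrank_eq, M.2]⟩

/-- The line `M d`. -/
def ProjLine.mulRight (d : H) (hd : d ≠ 0) (M : ProjLine F H) : ProjLine F H :=
  ⟨M.1.map (LinearMap.mulRight F d), by
    have hinj : Function.Injective (LinearMap.mulRight F d) :=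
      fun _ _ hab => mul_right_cancel₀ hd hab
    rw [← (Submodule.equivMapOfInjective _ hinj M.1).finrank_eq, M.2]⟩

/-- For a line `M` through `p`, the line `M p⁻¹` passes through `1`, so it is closed under
multiplication: hence `M` is closed under the ternary product `q p⁻¹ r`. -/
theorem IsQuaternionSkewField.mul_inv_mul_mem (hH : IsQuaternionSkewField F H) {M : ProjLine F H}
    {p q r : H} (hp : p ∈ M.1) (hq : q ∈ M.1) (hr : r ∈ M.1) : q * p⁻¹ * r ∈ M.1 := by
  -- For `p = 0` the product is `0`, since `0⁻¹ = 0`.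
  rcases eq_or_ne p 0 with rfl | hp0
  · simp
  obtain ⟨m, hm, hmeq⟩ := hH.mul_mem (M := M.mulRight p⁻¹ (inv_ne_zero hp0))
    ⟨p, hp, mul_inv_cancel₀ hp0⟩ ⟨q, hq, rfl⟩ ⟨r, hr, rfl⟩
  have : m = q * p⁻¹ * r := by
    refine mul_right_cancel₀ (inv_ne_zero hp0) ?_
    simpa [mul_assoc] using hmeq
  exact this ▸ hm

theorem IsQuaternionSkewField.mul_mem_of_leftParallel (hH : IsQuaternionSkewField F H)
    {M N : ProjLine F H} (h : LeftParallel F H M N) {p q a : H} (hp : p ∈ M.1) (hq : q ∈ M.1)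
    (ha : a ∈ N.1) : a * p⁻¹ * q ∈ N.1 := by
  obtain ⟨c, -, hcN⟩ := h
  rw [← hcN] at ha ⊢
  obtain ⟨m, hm, rfl⟩ := ha
  exact ⟨m * p⁻¹ * q, hH.mul_inv_mul_mem hp hm hq, by simp [mul_assoc]⟩

theorem IsQuaternionSkewField.mul_mem_of_rightParallel (hH : IsQuaternionSkewField F H)
    {M N : ProjLine F H} (h : RightParallel F H M N) {p q a : H} (hp : p ∈ M.1) (hq : q ∈ M.1)
    (ha : a ∈ N.1) : q * p⁻¹ * a ∈ N.1 := by
  obtain ⟨c, -, hcN⟩ := h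
  rw [← hcN] at ha ⊢
  obtain ⟨m, hm, rfl⟩ := ha
  exact ⟨q * p⁻¹ * m, hH.mul_inv_mul_mem hp hq hm, by simp [mul_assoc]⟩

theorem leftParallel_of_mul_mem {M N : ProjLine F H} {c : H} (hc : c ≠ 0) {p q : H}
    (h : LinearIndependent F ![p, q]) (hp : p ∈ M.1) (hq : q ∈ M.1) (hcp : c * p ∈ N.1)
    (hcq : c * q ∈ N.1) : LeftParallel F H M N := by
  refine ⟨c, hc, congrArg Subtype.val (ProjLine.eq_of_le (M := M.mulLeft c hc) ?_)⟩
  rintro _ ⟨x, hx, rfl⟩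
  obtain ⟨u, v, rfl⟩ := (ProjLine.mem_join h).1 ((ProjLine.join_eq h hp hq).symm ▸ hx)
  simpa [mul_add] using N.1.add_mem (N.1.smul_mem u hcp) (N.1.smul_mem v hcq)

theorem rightParallel_of_mul_mem {M N : ProjLine F H} {d : H} (hd : d ≠ 0) {p q : H}
    (h : LinearIndependent F ![p, q]) (hp : p ∈ M.1) (hq : q ∈ M.1) (hpd : p * d ∈ N.1)
    (hqd : q * d ∈ N.1) : RightParallel F H M N := by
  refine ⟨d, hd, congrArg Subtype.val (ProjLine.eq_of_le (M := M.mulRight d hd) ?_)⟩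
  rintro _ ⟨x, hx, rfl⟩
  obtain ⟨u, v, rfl⟩ := (ProjLine.mem_join h).1 ((ProjLine.join_eq h hp hq).symm ▸ hx)
  simpa [add_mul] using N.1.add_mem (N.1.smul_mem u hpd) (N.1.smul_mem v hqd)

theorem leftParallel_equivalence : Equivalence (LeftParallel F H) where
  refl M := ⟨1, one_ne_zero, by simp⟩
  symm := by
    rintro M N ⟨c, hc, h⟩
    refine ⟨c⁻¹, inv_ne_zero hc, ?_⟩
    rw [← h, ← Submodule.map_comp, ← LinearMap.mulLeft_mul, inv_mul_cancel₀ hc]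
    simp
  trans := by
    rintro M N K ⟨c, hc, h⟩ ⟨d, hd, h'⟩
    refine ⟨d * c, mul_ne_zero hd hc, ?_⟩
    rw [LinearMap.mulLeft_mul, Submodule.map_comp, h, h']

theorem rightParallel_equivalence : Equivalence (RightParallel F H) where
  refl M := ⟨1, one_ne_zero, by simp⟩
  symm := by
    rintro M N ⟨c, hc, h⟩
    refine ⟨c⁻¹, inv_ne_zero hc, ?_⟩
    rw [← h, ← Submodule.map_comp, ← LinearMap.mulRight_mul, mul_inv_cancel₀ hc]
    simp
  trans := by
    rintro M N K ⟨c, hc, h⟩ ⟨d, hd, h'⟩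
    refine ⟨c * d, mul_ne_zero hc hd, ?_⟩
    rw [LinearMap.mulRight_mul, Submodule.map_comp, h, h']

/-- Left parallel lines with a common point coincide. -/
theorem IsQuaternionSkewField.eq_of_leftParallel (hH : IsQuaternionSkewField F H)
    {M N : ProjLine F H} (h : LeftParallel F H M N) {x : H} (hx : x ≠ 0) (hM : x ∈ M.1)
    (hN : x ∈ N.1) : M = N := by
  refine ProjLine.eq_of_le fun y hy => ?_
  simpa [hx] using hH.mul_mem_of_leftParallel h hM hy hN

/-- Right parallel lines with a common point coincide. -/
theorem IsQuaternionSkewField.eq_of_rightParallel (hH : IsQuaternionSkewField F H)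
    {M N : ProjLine F H} (h : RightParallel F H M N) {x : H} (hx : x ≠ 0) (hM : x ∈ M.1)
    (hN : x ∈ N.1) : M = N := by
  refine ProjLine.eq_of_le fun y hy => ?_
  simpa [hx] using hH.mul_mem_of_rightParallel h hM hy hN

end Quaternion

/-! ### The double space axiom for a Clifford-like parallelism -/

section DoubleSpace

variable {F H : Type*} [Field F] [DivisionRing H] [Algebra F H]

/-- The lines which are `par`-parallel to `M` are all left parallel to `M`. -/
def IsLeftType (par : ProjLine F H → ProjLine F H → Prop) (M : ProjLine F H) : Prop :=
  ∀ N, par M N → LeftParallel F H M N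

/-- The lines which are `par`-parallel to `M` are all right parallel to `M`. -/
def IsRightType (par : ProjLine F H → ProjLine F H → Prop) (M : ProjLine F H) : Prop :=
  ∀ N, par M N → RightParallel F H M N

/-- An equivalence class cannot contain `N` and `K` such that `M` is only left parallel to `N` and
only right parallel to `K`, since `N` and `K` would be neither left nor right parallel. -/
theorem IsCliffordLike.isLeftType_or_isRightType {par : ProjLine F H → ProjLine F H → Prop}
    (h : IsCliffordLike (LeftParallel F H) (RightParallel F H) par) (M : ProjLine F H) :
    IsLeftType par M ∨ IsRightType par M := by
  by_contra hcon
  obtain ⟨hl, hr⟩ := not_or.1 hcon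
  obtain ⟨N, hN⟩ := not_forall.1 hl
  obtain ⟨K, hK⟩ := not_forall.1 hr
  obtain ⟨hMN, hNl⟩ := Classical.not_imp.1 hN
  obtain ⟨hMK, hKr⟩ := Classical.not_imp.1 hK
  have hNr := (h.left_or_right M N hMN).resolve_left hNl
  have hKl := (h.left_or_right M K hMK).resolve_right hKr
  have e := h.isParallelism.equivalence
  rcases h.left_or_right N K (e.trans (e.symm hMN) hMK) with hl | hr
  · exact hNl (leftParallel_equivalence.trans hKl (leftParallel_equivalence.symm hl))
  · exact hKr (rightParallel_equivalence.trans hNr hr)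

theorem IsLeftType.of_par {par : ProjLine F H → ProjLine F H → Prop} (he : Equivalence par)
    {M N : ProjLine F H} (hM : IsLeftType par M) (hMN : par M N) : IsLeftType par N :=
  fun K hNK => leftParallel_equivalence.trans (leftParallel_equivalence.symm (hM N hMN))
    (hM K (he.trans hMN hNK))

theorem IsRightType.of_par {par : ProjLine F H → ProjLine F H → Prop} (he : Equivalence par)
    {M N : ProjLine F H} (hM : IsRightType par M) (hMN : par M N) : IsRightType par N :=
  fun K hNK => rightParallel_equivalence.trans (rightParallel_equivalence.symm (hM N hMN))
    (hM K (he.trans hMN hNK))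

variable {par par' : ProjLine F H → ProjLine F H → Prop}

/-- If the line `A` joining `p₀` and `a` is of left type, then its parallel through `p₂` is spanned
by `p₂` and `p₂ p₀⁻¹ a`. It meets `N`, but not in the point `p₂` of `M`. -/
theorem IsProjectiveDoubleSpace.exists_mem_of_isLeftType (hH : IsQuaternionSkewField F H)
    (h : IsProjectiveDoubleSpace par par') {M N A : ProjLine F H} (hMN : par' M N)
    (hne : M ≠ N) {p₀ p₂ a : H} (hp : LinearIndependent F ![p₀, p₂]) (hp₀ : p₀ ∈ M.1)
    (hp₂ : p₂ ∈ M.1) (ha : a ∈ N.1) (ha0 : a ≠ 0) (hA₀ : p₀ ∈ A.1) (hAa : a ∈ A.1)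
    (hA : IsLeftType par A) : ∃ x : F, p₂ * p₀⁻¹ * a + x • p₂ ∈ N.1 := by
  have h0 : p₀ ≠ 0 := hp.ne_zero 0
  have h2 : p₂ ≠ 0 := hp.ne_zero 1
  obtain ⟨K, ⟨hAK, hK⟩, -⟩ := h.left.existsUnique_mem h2 A
  obtain ⟨q, hq0, hqK, hqN⟩ := h.exists_mem hMN hne hp hp₀ hp₂ ha ha0 hA₀ hAa hAK hK
  have hmem := hH.mul_mem_of_leftParallel (hA K hAK) hA₀ hAa hK
  have haM : a ∉ M.1 := fun haM => ha0 (h.right.eq_zero_of_mem hMN hne haM ha)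
  have hind : LinearIndependent F ![p₂, p₂ * p₀⁻¹ * a] := by
    refine (LinearIndependent.pair_iff' h2).2 fun s hs => haM ?_
    have : s • p₀ = a := by
      refine mul_left_cancel₀ (mul_ne_zero h2 (inv_ne_zero h0)) ?_
      rw [← hs, mul_smul_comm, inv_mul_cancel_right₀ h0]
    exact this ▸ M.1.smul_mem s hp₀
  rw [← ProjLine.join_eq hind hK hmem, ProjLine.mem_join] at hqK
  obtain ⟨u, v, rfl⟩ := hqK
  have hv : v ≠ 0 := by
    rintro rfl
    refine hq0 (h.right.eq_zero_of_mem hMN hne ?_ hqN)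
    simpa using M.1.smul_mem u hp₂
  refine ⟨v⁻¹ * u, ?_⟩
  have := N.1.smul_mem v⁻¹ hqN
  rwa [smul_add, smul_smul, smul_smul, inv_mul_cancel₀ hv, one_smul, add_comm] at this

/-- If the line `A` joining `p₀` and `a` is of right type, then its parallel through `p₂` is spanned
by `p₂` and `a p₀⁻¹ p₂`. It meets `N`, but not in the point `p₂` of `M`. -/
theorem IsProjectiveDoubleSpace.exists_mem_of_isRightType (hH : IsQuaternionSkewField F H)
    (h : IsProjectiveDoubleSpace par par') {M N A : ProjLine F H} (hMN : par' M N)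
    (hne : M ≠ N) {p₀ p₂ a : H} (hp : LinearIndependent F ![p₀, p₂]) (hp₀ : p₀ ∈ M.1)
    (hp₂ : p₂ ∈ M.1) (ha : a ∈ N.1) (ha0 : a ≠ 0) (hA₀ : p₀ ∈ A.1) (hAa : a ∈ A.1)
    (hA : IsRightType par A) : ∃ x : F, a * p₀⁻¹ * p₂ + x • p₂ ∈ N.1 := by
  have h0 : p₀ ≠ 0 := hp.ne_zero 0
  have h2 : p₂ ≠ 0 := hp.ne_zero 1
  obtain ⟨K, ⟨hAK, hK⟩, -⟩ := h.left.existsUnique_mem h2 A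
  obtain ⟨q, hq0, hqK, hqN⟩ := h.exists_mem hMN hne hp hp₀ hp₂ ha ha0 hA₀ hAa hAK hK
  have hmem := hH.mul_mem_of_rightParallel (hA K hAK) hA₀ hAa hK
  have haM : a ∉ M.1 := fun haM => ha0 (h.right.eq_zero_of_mem hMN hne haM ha)
  have hind : LinearIndependent F ![p₂, a * p₀⁻¹ * p₂] := by
    refine (LinearIndependent.pair_iff' h2).2 fun s hs => haM ?_
    have : s • p₀ = a := by
      refine mul_right_cancel₀ (mul_ne_zero (inv_ne_zero h0) h2) ?_
      rw [← mul_assoc, ← mul_assoc, ← hs, smul_mul_assoc, smul_mul_assoc, mul_inv_cancel₀ h0,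
        one_mul]
    exact this ▸ M.1.smul_mem s hp₀
  rw [← ProjLine.join_eq hind hK hmem, ProjLine.mem_join] at hqK
  obtain ⟨u, v, rfl⟩ := hqK
  have hv : v ≠ 0 := by
    rintro rfl
    refine hq0 (h.right.eq_zero_of_mem hMN hne ?_ hqN)
    simpa using M.1.smul_mem u hp₂
  refine ⟨v⁻¹ * u, ?_⟩
  have := N.1.smul_mem v⁻¹ hqN
  rwa [smul_add, smul_smul, smul_smul, inv_mul_cancel₀ hv, one_smul, add_comm] at this

/-- Two points `p`, `q` of `M` whose joins with `a` are of left type determine `N`: the axiom with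
`p₀ = p, p₂ = q` and with `p₀ = q, p₂ = q p⁻¹ q` puts two vectors into `N` which differ from
`q p⁻¹ a` by vectors of `M`, so they agree and `q p⁻¹ a ∈ N`. -/
theorem IsProjectiveDoubleSpace.rightParallel_of_isLeftType (hH : IsQuaternionSkewField F H)
    (h : IsProjectiveDoubleSpace par par') {M N A B : ProjLine F H} (hMN : par' M N)
    (hne : M ≠ N) {p q a : H} (hpq : LinearIndependent F ![p, q]) (hp : p ∈ M.1)
    (hq : q ∈ M.1) (ha : a ∈ N.1) (ha0 : a ≠ 0) (hAp : p ∈ A.1) (hAa : a ∈ A.1)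
    (hA : IsLeftType par A) (hBq : q ∈ B.1) (hBa : a ∈ B.1) (hB : IsLeftType par B) :
    RightParallel F H M N := by
  have hp0 : p ≠ 0 := hpq.ne_zero 0
  have hq0 : q ≠ 0 := hpq.ne_zero 1
  have hr : q * p⁻¹ * q ∈ M.1 := hH.mul_inv_mul_mem hp hq hq
  have hqr : LinearIndependent F ![q, q * p⁻¹ * q] := by
    refine (LinearIndependent.pair_iff' hq0).2 fun s hs => ?_
    refine (LinearIndependent.pair_iff' hp0).1 hpq s ?_
    have : s • (1 : H) = q * p⁻¹ := mul_right_cancel₀ hq0 (by rw [smul_mul_assoc, one_mul, hs])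
    rw [← inv_mul_cancel_right₀ hp0 q, ← this, smul_mul_assoc, one_mul]
  obtain ⟨x, hx⟩ := h.exists_mem_of_isLeftType hH hMN hne hpq hp hq ha ha0 hAp hAa hA
  obtain ⟨y, hy⟩ := h.exists_mem_of_isLeftType hH hMN hne hqr hq hr ha ha0 hBq hBa hB
  rw [mul_inv_cancel_right₀ hq0] at hy
  have hsub := N.1.sub_mem hx hy
  rw [add_sub_add_left_eq_sub] at hsub
  have hz := h.right.eq_zero_of_mem hMN hne
    (M.1.sub_mem (M.1.smul_mem x hq) (M.1.smul_mem y hr)) hsub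
  have hx0 : x = 0 := by
    refine ((LinearIndependent.pair_iff.1 hqr) x (-y) ?_).1
    rw [neg_smul, ← sub_eq_add_neg, hz]
  rw [hx0, zero_smul, add_zero] at hx
  refine rightParallel_of_mul_mem (mul_ne_zero (inv_ne_zero hp0) ha0) hpq hp hq ?_ ?_
  · rwa [mul_inv_cancel_left₀ hp0]
  · rwa [← mul_assoc]

/-- The mirror image of `IsProjectiveDoubleSpace.rightParallel_of_isLeftType`. -/
theorem IsProjectiveDoubleSpace.leftParallel_of_isRightType (hH : IsQuaternionSkewField F H)
    (h : IsProjectiveDoubleSpace par par') {M N A B : ProjLine F H} (hMN : par' M N)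
    (hne : M ≠ N) {p q a : H} (hpq : LinearIndependent F ![p, q]) (hp : p ∈ M.1)
    (hq : q ∈ M.1) (ha : a ∈ N.1) (ha0 : a ≠ 0) (hAp : p ∈ A.1) (hAa : a ∈ A.1)
    (hA : IsRightType par A) (hBq : q ∈ B.1) (hBa : a ∈ B.1) (hB : IsRightType par B) :
    LeftParallel F H M N := by
  have hp0 : p ≠ 0 := hpq.ne_zero 0
  have hq0 : q ≠ 0 := hpq.ne_zero 1
  have hr : q * p⁻¹ * q ∈ M.1 := hH.mul_inv_mul_mem hp hq hq
  have hqr : LinearIndependent F ![q, q * p⁻¹ * q] := by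
    refine (LinearIndependent.pair_iff' hq0).2 fun s hs => ?_
    refine (LinearIndependent.pair_iff' hp0).1 hpq s ?_
    have : s • (1 : H) = q * p⁻¹ := mul_right_cancel₀ hq0 (by rw [smul_mul_assoc, one_mul, hs])
    rw [← inv_mul_cancel_right₀ hp0 q, ← this, smul_mul_assoc, one_mul]
  obtain ⟨x, hx⟩ := h.exists_mem_of_isRightType hH hMN hne hpq hp hq ha ha0 hAp hAa hA
  obtain ⟨y, hy⟩ := h.exists_mem_of_isRightType hH hMN hne hqr hq hr ha ha0 hBq hBa hB
  have e : a * q⁻¹ * (q * p⁻¹ * q) = a * p⁻¹ * q := by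
    rw [mul_assoc q, ← mul_assoc, inv_mul_cancel_right₀ hq0, mul_assoc]
  rw [e] at hy
  have hsub := N.1.sub_mem hx hy
  rw [add_sub_add_left_eq_sub] at hsub
  have hz := h.right.eq_zero_of_mem hMN hne
    (M.1.sub_mem (M.1.smul_mem x hq) (M.1.smul_mem y hr)) hsub
  have hx0 : x = 0 := by
    refine ((LinearIndependent.pair_iff.1 hqr) x (-y) ?_).1
    rw [neg_smul, ← sub_eq_add_neg, hz]
  rw [hx0, zero_smul, add_zero] at hx
  refine leftParallel_of_mul_mem (mul_ne_zero ha0 (inv_ne_zero hp0)) hpq hp hq ?_ hx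
  rwa [inv_mul_cancel_right₀ hp0]

/-- The second parallelism of a double space whose first one is Clifford-like is Clifford-like too:
among three points of a line `M`, two have joins of the same type with a given point. -/
theorem IsProjectiveDoubleSpace.isCliffordLike (hH : IsQuaternionSkewField F H)
    (hpar : IsCliffordLike (LeftParallel F H) (RightParallel F H) par)
    (h : IsProjectiveDoubleSpace par par') :
    IsCliffordLike (LeftParallel F H) (RightParallel F H) par' := by
  refine ⟨h.right, fun M N hMN => ?_⟩
  rcases eq_or_ne M N with rfl | hne
  · exact Or.inl (leftParallel_equivalence.refl M)
  obtain ⟨p, hp, hp0⟩ := M.exists_ne_zero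
  obtain ⟨q, hq, hpq⟩ := M.exists_pair hp0
  obtain ⟨a, ha, ha0⟩ := N.exists_ne_zero
  have hpq' : LinearIndependent F ![p, p + q] := by
    rw [LinearIndependent.pair_iff] at hpq ⊢
    intro s t hst
    have := hpq (s + t) t (by rw [← hst, smul_add, add_smul, add_assoc])
    exact ⟨by simpa [this.2] using this.1, this.2⟩
  have hqq' : LinearIndependent F ![q, p + q] := by
    rw [LinearIndependent.pair_iff] at hpq ⊢
    intro s t hst
    have := hpq t (s + t) (by rw [← hst, smul_add, add_smul]; abel)
    exact ⟨by simpa [this.1] using this.2, this.1⟩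
  have hr : p + q ∈ M.1 := M.1.add_mem hp hq
  have haM : a ∉ M.1 := fun haM => ha0 (h.right.eq_zero_of_mem hMN hne haM ha)
  have hjoin : ∀ x ∈ M.1, x ≠ 0 → ∃ A : ProjLine F H, x ∈ A.1 ∧ a ∈ A.1 := fun x hx hx0 =>
    ⟨_, ProjLine.left_mem_join (pair_independent_of_mem_of_notMem hx hx0 haM),
      ProjLine.right_mem_join _⟩
  obtain ⟨A, hAp, hAa⟩ := hjoin p hp hp0
  obtain ⟨B, hBq, hBa⟩ := hjoin q hq (hpq.ne_zero 1)
  obtain ⟨C, hCr, hCa⟩ := hjoin (p + q) hr (hpq'.ne_zero 1)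
  rcases hpar.isLeftType_or_isRightType A with hA | hA <;>
  rcases hpar.isLeftType_or_isRightType B with hB | hB <;>
  rcases hpar.isLeftType_or_isRightType C with hC | hC
  · exact Or.inr (h.rightParallel_of_isLeftType hH hMN hne hpq hp hq ha ha0 hAp hAa hA hBq hBa hB)
  · exact Or.inr (h.rightParallel_of_isLeftType hH hMN hne hpq hp hq ha ha0 hAp hAa hA hBq hBa hB)
  · exact Or.inr (h.rightParallel_of_isLeftType hH hMN hne hpq' hp hr ha ha0 hAp hAa hA hCr hCa hC)
  · exact Or.inl (h.leftParallel_of_isRightType hH hMN hne hqq' hq hr ha ha0 hBq hBa hB hCr hCa hC)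
  · exact Or.inr (h.rightParallel_of_isLeftType hH hMN hne hqq' hq hr ha ha0 hBq hBa hB hCr hCa hC)
  · exact Or.inl (h.leftParallel_of_isRightType hH hMN hne hpq' hp hr ha ha0 hAp hAa hA hCr hCa hC)
  · exact Or.inl (h.leftParallel_of_isRightType hH hMN hne hpq hp hq ha ha0 hAp hAa hA hBq hBa hB)
  · exact Or.inl (h.leftParallel_of_isRightType hH hMN hne hpq hp hq ha ha0 hAp hAa hA hBq hBa hB)

end DoubleSpace

/-! ### Incompatibility of the two types -/

section Nonexistence

variable {F H : Type*} [Field F] [DivisionRing H] [Algebra F H]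

theorem IsQuaternionSkewField.eq_zero_of_mul_mem (hH : IsQuaternionSkewField F H)
    {B : ProjLine F H} (h1 : (1 : H) ∈ B.1) {a d : H} (ha : a ∉ B.1) (hd : d ∈ B.1)
    (hda : d * a ∈ B.1) : d = 0 := by
  by_contra hd0
  apply ha
  have := hH.mul_inv_mul_mem hd h1 hda
  rwa [one_mul, inv_mul_cancel_left₀ hd0] at this

theorem IsQuaternionSkewField.eq_zero_of_mul_mem' (hH : IsQuaternionSkewField F H)
    {B : ProjLine F H} (h1 : (1 : H) ∈ B.1) {a d : H} (ha : a ∉ B.1) (hd : d ∈ B.1)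
    (had : a * d ∈ B.1) : d = 0 := by
  by_contra hd0
  apply ha
  have := hH.mul_inv_mul_mem hd had h1
  rwa [mul_one, mul_inv_cancel_right₀ hd0] at this

/-- A line `B` through `1` is its own centralizer: if `a ∉ B`, then `H = B ⊕ B a`, and if `a`
commuted with `B`, then `B` would be central. -/
theorem IsQuaternionSkewField.mem_of_commute (hH : IsQuaternionSkewField F H) {B : ProjLine F H}
    (h1 : (1 : H) ∈ B.1) {a : H} (hcomm : ∀ t ∈ B.1, a * t = t * a) : a ∈ B.1 := by
  by_contra ha
  have hfd := hH.finiteDimensional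
  have ha0 : a ≠ 0 := fun e => ha (e ▸ B.1.zero_mem)
  have hinf : B.1 ⊓ (B.mulRight a ha0).1 = ⊥ := by
    refine (Submodule.eq_bot_iff _).2 ?_
    rintro _ ⟨hx, d, hd, rfl⟩
    have : d = 0 := hH.eq_zero_of_mul_mem h1 ha hd hx
    simp [this]
  have htop : B.1 ⊔ (B.mulRight a ha0).1 = ⊤ := by
    apply Submodule.eq_top_of_finrank_eq
    have := Submodule.finrank_sup_add_finrank_inf_eq B.1 (B.mulRight a ha0).1
    rw [hinf, finrank_bot, B.2, (B.mulRight a ha0).2] at this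
    rw [hH.finrank_eq]
    omega
  obtain ⟨t, ht, hind⟩ := B.exists_pair (one_ne_zero (α := H))
  have htB : ∀ x ∈ B.1, t * x = x * t := by
    intro x hx
    rw [← ProjLine.join_eq hind h1 ht, ProjLine.mem_join] at hx
    obtain ⟨u, v, rfl⟩ := hx
    simp [mul_add, add_mul]
  refine hH.not_independent_of_central (fun x => ?_) hind
  have hx : x ∈ B.1 ⊔ (B.mulRight a ha0).1 := htop ▸ Submodule.mem_top
  obtain ⟨y, hy, _, ⟨z, hz, rfl⟩, rfl⟩ := Submodule.mem_sup.1 hx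
  rw [LinearMap.mulRight_apply, mul_add, add_mul, htB y hy, ← mul_assoc, htB z hz, mul_assoc,
    mul_assoc, hcomm t ht]

variable {par par' : ProjLine F H → ProjLine F H → Prop}

/-- Let `B` be a line through `1` whose second parallel class is a right one, and let the join of
`1` and `a` be of right type. The `par'`-parallel to `B` through `a` is `B a`, and the axiom puts
`a t + x t` into it, where `x` may depend on `t`. Comparing `t` with `t + 1` gives `x = 0`. -/
theorem IsProjectiveDoubleSpace.mul_mul_inv_mem (hH : IsQuaternionSkewField F H)
    (h : IsProjectiveDoubleSpace par par') {A B : ProjLine F H} (hB : IsRightType par' B)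
    (hA : IsRightType par A) (hB1 : (1 : H) ∈ B.1) (hA1 : (1 : H) ∈ A.1) {a t : H}
    (haA : a ∈ A.1) (haB : a ∉ B.1) (ht : t ∈ B.1) : a * t * a⁻¹ ∈ B.1 := by
  have ha0 : a ≠ 0 := fun e => haB (e ▸ B.1.zero_mem)
  by_cases hind : LinearIndependent F ![1, t]
  · obtain ⟨N, ⟨hBN, haN⟩, -⟩ := h.right.existsUnique_mem ha0 B
    have hne : B ≠ N := fun e => haB (e ▸ haN)
    have hind' : LinearIndependent F ![1, t + 1] := by
      rw [LinearIndependent.pair_iff] at hind ⊢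
      intro u v huv
      have := hind (u + v) v (by rw [← huv, smul_add, add_smul]; abel)
      exact ⟨by simpa [this.2] using this.1, this.2⟩
    have ht1 : t + 1 ∈ B.1 := B.1.add_mem ht hB1
    obtain ⟨x, hx⟩ := h.exists_mem_of_isRightType hH hBN hne hind hB1 ht haN ha0 hA1 haA hA
    obtain ⟨y, hy⟩ := h.exists_mem_of_isRightType hH hBN hne hind' hB1 ht1 haN ha0 hA1 haA hA
    rw [inv_one, mul_one] at hx hy
    have hsub : y • (t + 1) - x • t ∈ N.1 := by
      convert N.1.sub_mem (N.1.sub_mem hy hx) haN using 1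
      rw [mul_add, mul_one]
      abel
    have hz := h.right.eq_zero_of_mem hBN hne
      (B.1.sub_mem (B.1.smul_mem y ht1) (B.1.smul_mem x ht)) hsub
    have hyx := LinearIndependent.pair_iff.1 hind y (y - x) (by
      rw [← hz, sub_smul, smul_add]; abel)
    have hx0 : x = 0 := by simpa [hyx.1] using hyx.2
    rw [hx0, zero_smul, add_zero] at hx
    have := hH.mul_mem_of_rightParallel (rightParallel_equivalence.symm (hB N hBN)) haN hx hB1
    rwa [mul_one] at this
  · rw [LinearIndependent.pair_iff' one_ne_zero] at hind
    push Not at hind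
    obtain ⟨u, rfl⟩ := hind
    simpa [ha0] using B.1.smul_mem u hB1

/-- The mirror image of `IsProjectiveDoubleSpace.mul_mul_inv_mem`. -/
theorem IsProjectiveDoubleSpace.inv_mul_mul_mem (hH : IsQuaternionSkewField F H)
    (h : IsProjectiveDoubleSpace par par') {A B : ProjLine F H} (hB : IsLeftType par' B)
    (hA : IsLeftType par A) (hB1 : (1 : H) ∈ B.1) (hA1 : (1 : H) ∈ A.1) {a t : H}
    (haA : a ∈ A.1) (haB : a ∉ B.1) (ht : t ∈ B.1) : a⁻¹ * (t * a) ∈ B.1 := by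
  have ha0 : a ≠ 0 := fun e => haB (e ▸ B.1.zero_mem)
  by_cases hind : LinearIndependent F ![1, t]
  · obtain ⟨N, ⟨hBN, haN⟩, -⟩ := h.right.existsUnique_mem ha0 B
    have hne : B ≠ N := fun e => haB (e ▸ haN)
    have hind' : LinearIndependent F ![1, t + 1] := by
      rw [LinearIndependent.pair_iff] at hind ⊢
      intro u v huv
      have := hind (u + v) v (by rw [← huv, smul_add, add_smul]; abel)
      exact ⟨by simpa [this.2] using this.1, this.2⟩
    have ht1 : t + 1 ∈ B.1 := B.1.add_mem ht hB1
    obtain ⟨x, hx⟩ := h.exists_mem_of_isLeftType hH hBN hne hind hB1 ht haN ha0 hA1 haA hA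
    obtain ⟨y, hy⟩ := h.exists_mem_of_isLeftType hH hBN hne hind' hB1 ht1 haN ha0 hA1 haA hA
    rw [inv_one, mul_one] at hx hy
    have hsub : y • (t + 1) - x • t ∈ N.1 := by
      convert N.1.sub_mem (N.1.sub_mem hy hx) haN using 1
      rw [add_mul, one_mul]
      abel
    have hz := h.right.eq_zero_of_mem hBN hne
      (B.1.sub_mem (B.1.smul_mem y ht1) (B.1.smul_mem x ht)) hsub
    have hyx := LinearIndependent.pair_iff.1 hind y (y - x) (by
      rw [← hz, sub_smul, smul_add]; abel)
    have hx0 : x = 0 := by simpa [hyx.1] using hyx.2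
    rw [hx0, zero_smul, add_zero] at hx
    have := hH.mul_mem_of_leftParallel (leftParallel_equivalence.symm (hB N hBN)) haN hx hB1
    rwa [one_mul] at this
  · rw [LinearIndependent.pair_iff' one_ne_zero] at hind
    push Not at hind
    obtain ⟨u, rfl⟩ := hind
    simpa [ha0] using B.1.smul_mem u hB1

/-- If the second parallel class of `B` is a right one, then every line `A ≠ B` through `1` fails
to be of right type for the first parallelism: for `a ∈ A \ B`, both `a` and `a + 1` would
normalize `B`, and this forces `a` to commute with `B`. -/
theorem IsProjectiveDoubleSpace.eq_of_isRightType (hH : IsQuaternionSkewField F H)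
    (h : IsProjectiveDoubleSpace par par') {A B : ProjLine F H} (hB : IsRightType par' B)
    (hA : IsRightType par A) (hB1 : (1 : H) ∈ B.1) (hA1 : (1 : H) ∈ A.1) : A = B := by
  refine ProjLine.eq_of_le fun a haA => ?_
  by_contra haB
  have ha1B : a + 1 ∉ B.1 := fun e => haB (by simpa using B.1.sub_mem e hB1)
  have ha0 : a ≠ 0 := fun e => haB (e ▸ B.1.zero_mem)
  have ha10 : a + 1 ≠ 0 := fun e => ha1B (e ▸ B.1.zero_mem)
  refine haB (hH.mem_of_commute hB1 fun t ht => ?_)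
  have hs := h.mul_mul_inv_mem hH hB hA hB1 hA1 haA haB ht
  have hs' := h.mul_mul_inv_mem hH hB hA hB1 hA1 (A.1.add_mem haA hA1) ha1B ht
  -- `s a = a t` and `s' (a + 1) = (a + 1) t`, so `(s - s') a = s' - t ∈ B`, whence `s = s' = t`.
  obtain ⟨s, hs_def⟩ : ∃ s, s = a * t * a⁻¹ := ⟨_, rfl⟩
  obtain ⟨s', hs'_def⟩ : ∃ s', s' = (a + 1) * t * (a + 1)⁻¹ := ⟨_, rfl⟩
  rw [← hs_def] at hs
  rw [← hs'_def] at hs'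
  have e : s * a = a * t := by rw [hs_def, inv_mul_cancel_right₀ ha0]
  have e' : s' * (a + 1) = (a + 1) * t := by rw [hs'_def, inv_mul_cancel_right₀ ha10]
  have key : (s - s') * a = s' - t := by
    rw [mul_add, add_mul, mul_one, one_mul, ← e] at e'
    rw [sub_mul, sub_eq_sub_iff_add_eq_add, ← e', add_comm]
  have hd := hH.eq_zero_of_mul_mem hB1 haB (B.1.sub_mem hs hs')
    (key ▸ B.1.sub_mem hs' ht)
  rw [hd, zero_mul] at key
  rw [← e, sub_eq_zero.1 hd, ← sub_eq_zero.1 key.symm]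

/-- The mirror image of `IsProjectiveDoubleSpace.eq_of_isRightType`. -/
theorem IsProjectiveDoubleSpace.eq_of_isLeftType (hH : IsQuaternionSkewField F H)
    (h : IsProjectiveDoubleSpace par par') {A B : ProjLine F H} (hB : IsLeftType par' B)
    (hA : IsLeftType par A) (hB1 : (1 : H) ∈ B.1) (hA1 : (1 : H) ∈ A.1) : A = B := by
  refine ProjLine.eq_of_le fun a haA => ?_
  by_contra haB
  have ha1B : a + 1 ∉ B.1 := fun e => haB (by simpa using B.1.sub_mem e hB1)
  have ha0 : a ≠ 0 := fun e => haB (e ▸ B.1.zero_mem)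
  have ha10 : a + 1 ≠ 0 := fun e => ha1B (e ▸ B.1.zero_mem)
  refine haB (hH.mem_of_commute hB1 fun t ht => ?_)
  have hs := h.inv_mul_mul_mem hH hB hA hB1 hA1 haA haB ht
  have hs' := h.inv_mul_mul_mem hH hB hA hB1 hA1 (A.1.add_mem haA hA1) ha1B ht
  obtain ⟨s, hs_def⟩ : ∃ s, s = a⁻¹ * (t * a) := ⟨_, rfl⟩
  obtain ⟨s', hs'_def⟩ : ∃ s', s' = (a + 1)⁻¹ * (t * (a + 1)) := ⟨_, rfl⟩
  rw [← hs_def] at hs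
  rw [← hs'_def] at hs'
  have e : a * s = t * a := by rw [hs_def, mul_inv_cancel_left₀ ha0]
  have e' : (a + 1) * s' = t * (a + 1) := by rw [hs'_def, mul_inv_cancel_left₀ ha10]
  have key : a * (s - s') = s' - t := by
    rw [mul_add, add_mul, mul_one, one_mul, ← e] at e'
    rw [mul_sub, sub_eq_sub_iff_add_eq_add, ← e', add_comm]
  have hd := hH.eq_zero_of_mul_mem' hB1 haB (B.1.sub_mem hs hs')
    (key ▸ B.1.sub_mem hs' ht)
  rw [hd, mul_zero] at key
  rw [← e, sub_eq_zero.1 hd, ← sub_eq_zero.1 key.symm]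

/-- If all lines through `1` are of left type, then so are all lines, and a parallelism contained
in `LeftParallel` is equal to it. -/
theorem IsParallelism.eq_leftParallel (hH : IsQuaternionSkewField F H) (h : IsParallelism par)
    (hl : ∀ M : ProjLine F H, (1 : H) ∈ M.1 → IsLeftType par M) : par = LeftParallel F H := by
  have hall : ∀ M, IsLeftType par M := fun M => by
    obtain ⟨N, ⟨hMN, hN⟩, -⟩ := h.existsUnique_mem one_ne_zero M
    exact (hl N hN).of_par h.equivalence (h.equivalence.symm hMN)
  funext M N
  refine propext ⟨hall M N, fun hMN => ?_⟩
  obtain ⟨x, hx, hx0⟩ := N.exists_ne_zero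
  obtain ⟨K, ⟨hMK, hK⟩, -⟩ := h.existsUnique_mem hx0 M
  have := hH.eq_of_leftParallel (leftParallel_equivalence.trans
    (leftParallel_equivalence.symm (hall M K hMK)) hMN) hx0 hK hx
  exact this ▸ hMK

/-- The mirror image of `IsParallelism.eq_leftParallel`. -/
theorem IsParallelism.eq_rightParallel (hH : IsQuaternionSkewField F H) (h : IsParallelism par)
    (hr : ∀ M : ProjLine F H, (1 : H) ∈ M.1 → IsRightType par M) : par = RightParallel F H := by
  have hall : ∀ M, IsRightType par M := fun M => by
    obtain ⟨N, ⟨hMN, hN⟩, -⟩ := h.existsUnique_mem one_ne_zero M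
    exact (hr N hN).of_par h.equivalence (h.equivalence.symm hMN)
  funext M N
  refine propext ⟨hall M N, fun hMN => ?_⟩
  obtain ⟨x, hx, hx0⟩ := N.exists_ne_zero
  obtain ⟨K, ⟨hMK, hK⟩, -⟩ := h.existsUnique_mem hx0 M
  have := hH.eq_of_rightParallel (rightParallel_equivalence.trans
    (rightParallel_equivalence.symm (hall M K hMK)) hMN) hx0 hK hx
  exact this ▸ hMK

/-- Two lines do not cover the space, so there is a third line through `1`. -/
theorem IsQuaternionSkewField.exists_line_ne (hH : IsQuaternionSkewField F H)
    {A B : ProjLine F H} (hA : (1 : H) ∈ A.1) :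
    ∃ C : ProjLine F H, (1 : H) ∈ C.1 ∧ A ≠ C ∧ B ≠ C := by
  have hex : ∀ M : ProjLine F H, ∃ x, x ∉ M.1 := by
    intro M
    by_contra! hM
    have h2 := M.2
    rw [Submodule.eq_top_iff'.2 hM, finrank_top, hH.finrank_eq] at h2
    omega
  -- If `x ∈ B \ A` and `y ∈ A \ B`, then `x + y` is in neither line.
  obtain ⟨x, hxA, hxB⟩ : ∃ x, x ∉ A.1 ∧ x ∉ B.1 := by
    obtain ⟨x, hx⟩ := hex A
    obtain ⟨y, hy⟩ := hex B
    by_cases hxB : x ∈ B.1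
    · by_cases hyA : y ∈ A.1
      · exact ⟨x + y, fun e => hx ((A.1.add_mem_iff_left hyA).1 e),
          fun e => hy ((B.1.add_mem_iff_right hxB).1 e)⟩
      · exact ⟨y, hyA, hy⟩
    · exact ⟨x, hx, hxB⟩
  have hind := pair_independent_of_mem_of_notMem hA one_ne_zero hxA
  have hxC := ProjLine.right_mem_join hind
  exact ⟨ProjLine.join 1 x hind, ProjLine.left_mem_join hind, fun e => hxA (e ▸ hxC),
    fun e => hxB (e ▸ hxC)⟩

end Nonexistence

theorem theorem4p12 {F H : Type*} [Field F] [DivisionRing H] [Algebra F H]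
    (hH : IsQuaternionSkewField F H)
    (par : ProjLine F H → ProjLine F H → Prop)
    (hpar : IsCliffordLike (LeftParallel F H) (RightParallel F H) par)
    (hleft : par ≠ LeftParallel F H) (hright : par ≠ RightParallel F H) :
    ¬ ∃ par' : ProjLine F H → ProjLine F H → Prop, IsProjectiveDoubleSpace par par' := by
  rintro ⟨par', h⟩
  obtain ⟨R, hR1, hR⟩ : ∃ R : ProjLine F H, (1 : H) ∈ R.1 ∧ IsRightType par R := by
    by_contra! hcon
    exact hleft (h.left.eq_leftParallel hH fun M hM =>
      (hpar.isLeftType_or_isRightType M).resolve_right (hcon M hM))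
  obtain ⟨L, hL1, hL⟩ : ∃ L : ProjLine F H, (1 : H) ∈ L.1 ∧ IsLeftType par L := by
    by_contra! hcon
    exact hright (h.left.eq_rightParallel hH fun M hM =>
      (hpar.isLeftType_or_isRightType M).resolve_left (hcon M hM))
  obtain ⟨B, hB1, hRB, hLB⟩ := hH.exists_line_ne (A := R) (B := L) hR1
  rcases (h.isCliffordLike hH hpar).isLeftType_or_isRightType B with hB | hB
  · exact hLB (h.eq_of_isLeftType hH hB hL hB1 hL1)
  · exact hRB (h.eq_of_isRightType hH hB hR hB1 hR1)
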